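/- Let $\mathbb C^{+2}=\{(z_1,z_2)\in\mathbb C^2:\Im z_1>0,\ \Im z_2>0\}$, and let $q\colon\mathbb C^{+2}\to\mathbb C$ be a Herglotz--Nevanlinna function in two variables, that is, $q$ is holomorphic and $\Im q\ge 0$ on $\mathbb C^{+2}$. For $z\in\mathbb C^{+2}$ and $t\in\mathbb R^2$ put $$K(z,t)=-\frac{i}{2}\Big(\frac1{t_1-z_1}-\frac1{t_1+i}\Big)\Big(\frac1{t_2-z_2}-\frac1{t_2+i}\Big)-\frac{i}{(1+t_1^2)(1+t_2^2)}.$$ We say that $a\in\mathbb R$, $b_1,b_2\ge 0$ and a positive Borel measure $\mu$ on $\mathbb R^2$ represent $q$ if $$\iint_{\mathbb R^2}\frac{d\mu(t_1,t_2)}{(1+t_1^2)(1+t_2^2)}<\infty,$$ $$\iint_{\mathbb R^2}\Re\Big[\Big(\frac1{t_1-\overline{z_1}}-\frac1{t_1+i}\Big)\Big(\frac1{t_2-z_2}-\frac1{t_2-i}\Big)\Big]\,d\mu(t_1,t_2)=0\quad\text{for all }z\in\mathbb C^{+2},$$ and $$q(z_1,z_2)=a+b_1z_1+b_2z_2+\frac1{\pi^2}\iint_{\mathbb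 R^2}K(z,t)\,d\mu(t)\quad\text{for all }z\in\mathbb C^{+2}.$$ (1) Suppose that $a,b_1,b_2,\mu$ represent $q$, and let $\psi\colon\mathbb R^2\to\mathbb R$ be a $C^1$ function for which there is a constant $C\ge 0$ with $|\psi(x_1,x_2)|\le \dfrac{C}{(1+x_1^2)(1+x_2^2)}$ for all $(x_1,x_2)\in\mathbb R^2$. Then $\psi$ is $\mu$-integrable, the function $x\mapsto\psi(x)\,\Im q(x_1+iy_1,x_2+iy_2)$ is Lebesgue integrable on $\mathbb R^2$ for all $y_1,y_2>0$, and $$\iint_{\mathbb R^2}\psi(t_1,t_2)\,d\mu(t_1,t_2)=\lim_{\substack{y_1\downarrow 0\\ y_2\downarrow 0}}\iint_{\mathbb R^2}\psi(x_1,x_2)\,\Im[q(x_1+iy_1,x_2+iy_2)]\,dx_1\,dx_2,$$ where the limit is the joint limit in $(y_1,y_2)$. (2) The representing measure is uniquely determined by $q$: if $a,b_1,b_2,\mu$ represent $q$ and $a',b_1',b_2',\mu'$ represent $q$, then $\mu=\mu'$. -/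

import Mathlib

open MeasureTheory Filter Topology

/-- The poly-upper half-plane `ℂ⁺²`. -/
def polyUpperHalfPlane : Set (ℂ × ℂ) :=
  {z | 0 < z.1.im ∧ 0 < z.2.im}

/-- Herglotz-Nevanlinna functions in two variables: holomorphic on the poly-upper half-plane
with non-negative imaginary part there (the values of `q` elsewhere are irrelevant). -/
structure IsHerglotzNevanlinna (q : ℂ × ℂ → ℂ) : Prop where
  holomorphic : DifferentiableOn ℂ q polyUpperHalfPlane
  im_nonneg : ∀ z ∈ polyUpperHalfPlane, 0 ≤ (q z).im

/-- The kernel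
`K(z, t) = -(i/2) (1/(t₁-z₁) - 1/(t₁+i)) (1/(t₂-z₂) - 1/(t₂+i)) - i/((1+t₁²)(1+t₂²))`. -/
noncomputable def kernelK (z : ℂ × ℂ) (t : ℝ × ℝ) : ℂ :=
  -(Complex.I / 2) * (1 / ((t.1 : ℂ) - z.1) - 1 / ((t.1 : ℂ) + Complex.I))
      * (1 / ((t.2 : ℂ) - z.2) - 1 / ((t.2 : ℂ) + Complex.I))
    - Complex.I / ((1 + (t.1 : ℂ) ^ 2) * (1 + (t.2 : ℂ) ^ 2))

/-- The growth condition `∬ 1/((1+t₁²)(1+t₂²)) dμ < ∞`. -/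
def GrowthCondition (μ : Measure (ℝ × ℝ)) : Prop :=
  Integrable (fun t : ℝ × ℝ => 1 / ((1 + t.1 ^ 2) * (1 + t.2 ^ 2))) μ

/-- The Nevanlinna condition
`∬ Re[(1/(t₁-z̄₁) - 1/(t₁+i)) (1/(t₂-z₂) - 1/(t₂-i))] dμ = 0` for all `z` in the poly-upper
half-plane. Under the growth condition the integrand is always integrable. -/
def NevanlinnaCondition (μ : Measure (ℝ × ℝ)) : Prop :=
  ∀ z ∈ polyUpperHalfPlane,
    ∫ t : ℝ × ℝ,
      ((1 / ((t.1 : ℂ) - (starRingEnd ℂ) z.1) - 1 / ((t.1 : ℂ) + Complex.I))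
        * (1 / ((t.2 : ℂ) - z.2) - 1 / ((t.2 : ℂ) - Complex.I))).re ∂μ = 0

/-- `q` is represented by the numbers `a`, `b₁, b₂ ≥ 0` and the positive Borel measure `μ`:
`μ` satisfies the growth condition and the Nevanlinna condition, and
`q(z) = a + b₁ z₁ + b₂ z₂ + π⁻² ∬ K(z, t) dμ(t)` on the poly-upper half-plane. -/
structure IsRepresentation (q : ℂ × ℂ → ℂ) (a b₁ b₂ : ℝ) (μ : Measure (ℝ × ℝ)) : Prop where
  b₁_nonneg : 0 ≤ b₁
  b₂_nonneg : 0 ≤ b₂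
  growth : GrowthCondition μ
  nevanlinna : NevanlinnaCondition μ
  eq : ∀ z ∈ polyUpperHalfPlane,
    q z = (a : ℂ) + (b₁ : ℂ) * z.1 + (b₂ : ℂ) * z.2
      + (1 / (Real.pi : ℂ) ^ 2) * ∫ t : ℝ × ℝ, kernelK z t ∂μ

/-! The imaginary part of `kernelK` is the product Poisson kernel minus half the Nevanlinna
integrand (`im_kernelK_eq`). The Nevanlinna condition removes the latter, so `Im q` is a linear term
in `y` plus `π⁻²` times the Poisson integral of `μ` (`IsRepresentation.im_eq`).

Integrating against `ψ` and applying Fubini moves the Poisson average onto `ψ`. This average tends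
pointwise to `π² ψ`, and for `y₁, y₂ ≤ 1` it is dominated by a multiple of `growthWeight`, which is
`μ`-integrable; dominated convergence gives the inversion formula, the linear term vanishing in the
limit.

For uniqueness, the formula determines `∫ ψ dμ` for every continuous `ψ` bounded by a multiple of
the weight, and these integrals determine `μ` (`measure_ext_of_integral_eq`). -/

/-! ### Poisson kernel in one variable against the weight. -/

/-- The (unnormalised) Poisson kernel of the upper half-plane. -/
noncomputable def poissonUHP (y t x : ℝ) : ℝ := y / ((x - t) ^ 2 + y ^ 2)

/-- The weight `1 / ((1 + x₁²)(1 + x₂²))` of the growth condition. -/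
noncomputable def growthWeight (x : ℝ × ℝ) : ℝ := (1 + x.1 ^ 2)⁻¹ * (1 + x.2 ^ 2)⁻¹

lemma poissonUHP_pos {y : ℝ} (hy : 0 < y) (t x : ℝ) : 0 < poissonUHP y t x := by
  unfold poissonUHP; positivity

lemma growthWeight_pos (x : ℝ × ℝ) : 0 < growthWeight x := by
  unfold growthWeight; positivity

lemma continuous_growthWeight : Continuous growthWeight := by
  unfold growthWeight
  refine Continuous.mul ?_ ?_
  · exact Continuous.inv₀ (by fun_prop) fun x => by positivity
  · exact Continuous.inv₀ (by fun_prop) fun x => by positivity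

lemma growthWeight_eq (x : ℝ × ℝ) :
    growthWeight x = 1 / ((1 + x.1 ^ 2) * (1 + x.2 ^ 2)) := by
  rw [growthWeight, one_div, mul_inv]

lemma integrable_growthWeight : Integrable growthWeight :=
  integrable_inv_one_add_sq.mul_prod integrable_inv_one_add_sq

lemma poissonUHP_eq {y : ℝ} (hy : 0 < y) (t x : ℝ) :
    poissonUHP y t x = y⁻¹ * (1 + ((x - t) / y) ^ 2)⁻¹ := by
  unfold poissonUHP
  field_simp
  ring

lemma continuous_poissonUHP {y : ℝ} (hy : 0 < y) :
    Continuous fun p : ℝ × ℝ => poissonUHP y p.1 p.2 := by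
  unfold poissonUHP
  exact Continuous.div (by fun_prop) (by fun_prop) fun p => by positivity

lemma integrable_poissonUHP {y : ℝ} (hy : 0 < y) (t : ℝ) : Integrable (poissonUHP y t) := by
  have h := ((integrable_inv_one_add_sq.comp_div hy.ne').comp_sub_right t).const_mul y⁻¹
  exact h.congr (.of_forall fun x => (poissonUHP_eq hy t x).symm)

lemma integral_poissonUHP {y : ℝ} (hy : 0 < y) (t : ℝ) : ∫ x, poissonUHP y t x = Real.pi := by
  simp_rw [poissonUHP_eq hy, integral_const_mul]
  rw [integral_sub_right_eq_self (fun x : ℝ => (1 + (x / y) ^ 2)⁻¹) t,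
    Measure.integral_comp_div (fun x : ℝ => (1 + x ^ 2)⁻¹) y, integral_univ_inv_one_add_sq,
    abs_of_pos hy, smul_eq_mul, inv_mul_cancel_left₀ hy.ne']

/-- Comes from `1 + t² ≤ 2(1 + x²) + 2((x - t)² + y²)`, whose slack is `1 + (2x - t)² + 2y²`. It
trades decay in `x` for decay in `t`, so that Poisson averages of the weight are again bounded by
the weight. -/
lemma inv_one_add_sq_mul_poissonUHP_le {y : ℝ} (hy : 0 < y) (t x : ℝ) :
    (1 + x ^ 2)⁻¹ * poissonUHP y t x ≤
      (1 + t ^ 2)⁻¹ * (2 * poissonUHP y t x + 2 * y * (1 + x ^ 2)⁻¹) := by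
  have hx : 0 < 1 + x ^ 2 := by positivity
  have ht : 0 < 1 + t ^ 2 := by positivity
  have hd : 0 < (x - t) ^ 2 + y ^ 2 := by positivity
  unfold poissonUHP
  have e : (1 + t ^ 2)⁻¹ * (2 * (y / ((x - t) ^ 2 + y ^ 2)) + 2 * y * (1 + x ^ 2)⁻¹)
      - (1 + x ^ 2)⁻¹ * (y / ((x - t) ^ 2 + y ^ 2)) =
      y * (1 + (2 * x - t) ^ 2 + 2 * y ^ 2)
        / ((1 + t ^ 2) * (1 + x ^ 2) * ((x - t) ^ 2 + y ^ 2)) := by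
    field_simp
    ring
  have : 0 ≤ y * (1 + (2 * x - t) ^ 2 + 2 * y ^ 2)
        / ((1 + t ^ 2) * (1 + x ^ 2) * ((x - t) ^ 2 + y ^ 2)) := by positivity
  linarith

lemma integrable_inv_one_add_sq_mul_poissonUHP {y : ℝ} (hy : 0 < y) (t : ℝ) :
    Integrable fun x => (1 + x ^ 2)⁻¹ * poissonUHP y t x := by
  refine Integrable.mono' (integrable_poissonUHP hy t) ?_ (.of_forall fun x => ?_)
  · exact (integrable_inv_one_add_sq.aestronglyMeasurable).mul
      (integrable_poissonUHP hy t).aestronglyMeasurable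
  · have h := poissonUHP_pos hy t x
    rw [Real.norm_of_nonneg (by positivity)]
    exact mul_le_of_le_one_left h.le (inv_le_one_of_one_le₀ (by nlinarith [sq_nonneg x]))

lemma integral_inv_one_add_sq_mul_poissonUHP_le {y : ℝ} (hy : 0 < y) (t : ℝ) :
    ∫ x, (1 + x ^ 2)⁻¹ * poissonUHP y t x ≤ 2 * Real.pi * (1 + y) * (1 + t ^ 2)⁻¹ := by
  have h1 : Integrable fun x => 2 * poissonUHP y t x := (integrable_poissonUHP hy t).const_mul 2
  have h2 : Integrable fun x : ℝ => 2 * y * (1 + x ^ 2)⁻¹ :=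
    integrable_inv_one_add_sq.const_mul (2 * y)
  calc _ ≤ ∫ x, (1 + t ^ 2)⁻¹ * (2 * poissonUHP y t x + 2 * y * (1 + x ^ 2)⁻¹) :=
        integral_mono (integrable_inv_one_add_sq_mul_poissonUHP hy t)
          ((h1.add h2).const_mul _) (inv_one_add_sq_mul_poissonUHP_le hy t)
    _ = _ := by
        rw [integral_const_mul, integral_add h1 h2, integral_const_mul, integral_const_mul,
          integral_poissonUHP hy, integral_univ_inv_one_add_sq]
        ring

/-! ### Product Poisson kernel: domination and Fubini. -/

/-- The product Poisson kernel of the poly-upper half-plane. -/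
noncomputable def poissonProd (y t x : ℝ × ℝ) : ℝ :=
  poissonUHP y.1 t.1 x.1 * poissonUHP y.2 t.2 x.2

lemma poissonProd_pos {y : ℝ × ℝ} (h1 : 0 < y.1) (h2 : 0 < y.2) (t x : ℝ × ℝ) :
    0 < poissonProd y t x := mul_pos (poissonUHP_pos h1 _ _) (poissonUHP_pos h2 _ _)

lemma continuous_poissonProd {y : ℝ × ℝ} (h1 : 0 < y.1) (h2 : 0 < y.2) :
    Continuous fun p : (ℝ × ℝ) × (ℝ × ℝ) => poissonProd y p.1 p.2 := by
  unfold poissonProd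
  exact ((continuous_poissonUHP h1).comp (g := fun p : ℝ × ℝ => poissonUHP y.1 p.1 p.2)
      (f := fun p : (ℝ × ℝ) × (ℝ × ℝ) => (p.1.1, p.2.1)) (by fun_prop)).mul
    ((continuous_poissonUHP h2).comp (g := fun p : ℝ × ℝ => poissonUHP y.2 p.1 p.2)
      (f := fun p : (ℝ × ℝ) × (ℝ × ℝ) => (p.1.2, p.2.2)) (by fun_prop))

lemma growthWeight_mul_poissonProd (y t x : ℝ × ℝ) :
    growthWeight x * poissonProd y t x =
      ((1 + x.1 ^ 2)⁻¹ * poissonUHP y.1 t.1 x.1) * ((1 + x.2 ^ 2)⁻¹ * poissonUHP y.2 t.2 x.2) := by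
  unfold growthWeight poissonProd; ring

lemma integrable_growthWeight_mul_poissonProd {y : ℝ × ℝ} (h1 : 0 < y.1) (h2 : 0 < y.2)
    (t : ℝ × ℝ) : Integrable fun x => growthWeight x * poissonProd y t x := by
  simp_rw [growthWeight_mul_poissonProd]
  exact (integrable_inv_one_add_sq_mul_poissonUHP h1 t.1).mul_prod
    (integrable_inv_one_add_sq_mul_poissonUHP h2 t.2)

lemma integral_growthWeight_mul_poissonProd_le {y : ℝ × ℝ} (h1 : 0 < y.1) (h2 : 0 < y.2)
    (t : ℝ × ℝ) : ∫ x, growthWeight x * poissonProd y t x ≤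
      (2 * Real.pi) ^ 2 * ((1 + y.1) * (1 + y.2)) * growthWeight t := by
  simp_rw [growthWeight_mul_poissonProd]
  rw [Measure.volume_eq_prod, integral_prod_mul
    (fun x => (1 + x ^ 2)⁻¹ * poissonUHP y.1 t.1 x) (fun x => (1 + x ^ 2)⁻¹ * poissonUHP y.2 t.2 x)]
  refine (mul_le_mul (integral_inv_one_add_sq_mul_poissonUHP_le h1 t.1)
    (integral_inv_one_add_sq_mul_poissonUHP_le h2 t.2) (integral_nonneg fun x => ?_)
    (by positivity)).trans_eq ?_
  · have := poissonUHP_pos h2 t.2 x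
    dsimp only [Pi.zero_apply]
    positivity
  · unfold growthWeight; ring

lemma integrable_mul_poissonProd {ψ : ℝ × ℝ → ℝ} {C : ℝ} (hψ : Continuous ψ)
    (hC : ∀ x, |ψ x| ≤ C * growthWeight x) {y : ℝ × ℝ} (h1 : 0 < y.1) (h2 : 0 < y.2)
    (t : ℝ × ℝ) : Integrable fun x => ψ x * poissonProd y t x := by
  refine ((integrable_growthWeight_mul_poissonProd h1 h2 t).const_mul C).mono' ?_
    (.of_forall fun x => ?_)
  · exact (hψ.mul ((continuous_poissonProd h1 h2).comp
      (continuous_const (y := t) |>.prodMk continuous_id))).aestronglyMeasurable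
  · rw [norm_mul, Real.norm_of_nonneg (poissonProd_pos h1 h2 t x).le, ← mul_assoc]
    exact mul_le_mul_of_nonneg_right (hC x) (poissonProd_pos h1 h2 t x).le

lemma integral_norm_mul_poissonProd_le {ψ : ℝ × ℝ → ℝ} {C : ℝ} (hψ : Continuous ψ)
    (hC : ∀ x, |ψ x| ≤ C * growthWeight x) {y : ℝ × ℝ} (h1 : 0 < y.1) (h2 : 0 < y.2)
    (t : ℝ × ℝ) : ∫ x, ‖ψ x * poissonProd y t x‖ ≤
      C * ((2 * Real.pi) ^ 2 * ((1 + y.1) * (1 + y.2)) * growthWeight t) := by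
  have hC0 : 0 ≤ C := nonneg_of_mul_nonneg_left ((abs_nonneg _).trans (hC 0)) (growthWeight_pos 0)
  calc _ ≤ ∫ x, C * (growthWeight x * poissonProd y t x) := by
        refine integral_mono (integrable_mul_poissonProd hψ hC h1 h2 t).norm
          ((integrable_growthWeight_mul_poissonProd h1 h2 t).const_mul C) fun x => ?_
        dsimp only
        rw [norm_mul, Real.norm_of_nonneg (poissonProd_pos h1 h2 t x).le, ← mul_assoc]
        exact mul_le_mul_of_nonneg_right (hC x) (poissonProd_pos h1 h2 t x).le
    _ ≤ _ := by
        rw [integral_const_mul]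
        exact mul_le_mul_of_nonneg_left (integral_growthWeight_mul_poissonProd_le h1 h2 t) hC0

lemma integrable_of_le_growthWeight {μ : Measure (ℝ × ℝ)} (hμ : Integrable growthWeight μ)
    {ψ : ℝ × ℝ → ℝ} {C : ℝ} (hψ : Continuous ψ) (hC : ∀ x, |ψ x| ≤ C * growthWeight x) :
    Integrable ψ μ :=
  (hμ.const_mul C).mono' hψ.aestronglyMeasurable (.of_forall hC)

lemma integrable_prod_mul_poissonProd {μ : Measure (ℝ × ℝ)} [SFinite μ]
    (hμ : Integrable growthWeight μ) {ψ : ℝ × ℝ → ℝ} {C : ℝ} (hψ : Continuous ψ)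
    (hC : ∀ x, |ψ x| ≤ C * growthWeight x) {y : ℝ × ℝ} (h1 : 0 < y.1) (h2 : 0 < y.2) :
    Integrable (fun p : (ℝ × ℝ) × (ℝ × ℝ) => ψ p.1 * poissonProd y p.2 p.1)
      (volume.prod μ) := by
  have hm : Continuous fun p : (ℝ × ℝ) × (ℝ × ℝ) => ψ p.1 * poissonProd y p.2 p.1 :=
    (hψ.comp continuous_fst).mul ((continuous_poissonProd h1 h2).comp continuous_swap)
  refine (integrable_prod_iff' hm.aestronglyMeasurable).2
    ⟨.of_forall fun t => integrable_mul_poissonProd hψ hC h1 h2 t, ?_⟩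
  refine ((hμ.const_mul ((2 * Real.pi) ^ 2 * ((1 + y.1) * (1 + y.2)))).const_mul C).mono' ?_
    (.of_forall fun t => ?_)
  · exact (hm.comp continuous_swap).norm.stronglyMeasurable.integral_prod_right.aestronglyMeasurable
  · rw [Real.norm_of_nonneg (integral_nonneg fun x => norm_nonneg _)]
    exact integral_norm_mul_poissonProd_le hψ hC h1 h2 t

/-! ### The Poisson kernel as an approximate identity. -/

lemma integral_prod_comp_mul_left (f : ℝ × ℝ → ℝ) {a b : ℝ} (ha : 0 < a) (hb : 0 < b) :
    ∫ s : ℝ × ℝ, f (a * s.1, b * s.2) = a⁻¹ * b⁻¹ * ∫ x, f x := by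
  let e : ℝ × ℝ ≃ₜ ℝ × ℝ := (Homeomorph.mulLeft₀ a ha.ne').prodCongr (Homeomorph.mulLeft₀ b hb.ne')
  have he : Measure.map e volume = ENNReal.ofReal (a⁻¹ * b⁻¹) • (volume : Measure (ℝ × ℝ)) := by
    have : (e : ℝ × ℝ → ℝ × ℝ) = Prod.map (a * ·) (b * ·) := rfl
    rw [this, Measure.volume_eq_prod, ← Measure.map_prod_map _ _ (by fun_prop) (by fun_prop),
      Real.map_volume_mul_left ha.ne', Real.map_volume_mul_left hb.ne', Measure.prod_smul_left,
      Measure.prod_smul_right, smul_smul, abs_of_pos (inv_pos.2 ha), abs_of_pos (inv_pos.2 hb),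
      ENNReal.ofReal_mul (inv_pos.2 ha).le]
  have := e.measurableEmbedding.integral_map (μ := volume) f
  rw [he, integral_smul_measure, ENNReal.toReal_ofReal (by positivity)] at this
  exact this.symm

/-- The substitution `x = t + y s` moves all dependence on `y` into `ψ`. The remaining factor, the
Poisson kernel at height one centred at the origin, coincides with `growthWeight`. -/
lemma integral_mul_poissonProd (ψ : ℝ × ℝ → ℝ) {y : ℝ × ℝ} (h1 : 0 < y.1) (h2 : 0 < y.2)
    (t : ℝ × ℝ) : ∫ x, ψ x * poissonProd y t x =
      ∫ s, ψ (y.1 * s.1 + t.1, y.2 * s.2 + t.2) * growthWeight s := by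
  rw [← integral_add_right_eq_self (fun x => ψ x * poissonProd y t x) t]
  have h := integral_prod_comp_mul_left
    (fun x => y.1 * y.2 * (ψ (x + t) * poissonProd y t (x + t))) h1 h2
  simp only [integral_const_mul] at h
  rw [← mul_assoc, ← mul_inv, inv_mul_cancel₀ (mul_pos h1 h2).ne', one_mul] at h
  rw [← h, ← integral_const_mul]
  congr 1
  funext s
  have e : ((y.1 * s.1, y.2 * s.2) + t : ℝ × ℝ) = (y.1 * s.1 + t.1, y.2 * s.2 + t.2) := rfl
  simp only [e, poissonProd, poissonUHP_eq h1, poissonUHP_eq h2, growthWeight,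
    add_sub_cancel_right, mul_div_cancel_left₀ _ h1.ne', mul_div_cancel_left₀ _ h2.ne']
  field_simp

lemma tendsto_integral_mul_poissonProd {ψ : ℝ × ℝ → ℝ} {C : ℝ} (hψ : Continuous ψ)
    (hC : ∀ x, |ψ x| ≤ C) (t : ℝ × ℝ) :
    Tendsto (fun y : ℝ × ℝ => ∫ x, ψ x * poissonProd y t x)
      (𝓝[>] (0 : ℝ) ×ˢ 𝓝[>] (0 : ℝ)) (𝓝 (Real.pi ^ 2 * ψ t)) := by
  have hpos : ∀ᶠ y : ℝ × ℝ in 𝓝[>] (0 : ℝ) ×ˢ 𝓝[>] (0 : ℝ), 0 < y.1 ∧ 0 < y.2 :=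
    (eventually_mem_nhdsWithin (a := (0 : ℝ)) (s := Set.Ioi 0)).prod_mk eventually_mem_nhdsWithin
  have hle : 𝓝[>] (0 : ℝ) ×ˢ 𝓝[>] (0 : ℝ) ≤ 𝓝 ((0 : ℝ), (0 : ℝ)) := by
    rw [nhds_prod_eq]
    exact Filter.prod_mono nhdsWithin_le_nhds nhdsWithin_le_nhds
  have key : Tendsto
      (fun y : ℝ × ℝ => ∫ s, ψ (y.1 * s.1 + t.1, y.2 * s.2 + t.2) * growthWeight s)
      (𝓝[>] (0 : ℝ) ×ˢ 𝓝[>] (0 : ℝ)) (𝓝 (∫ s, ψ t * growthWeight s)) := by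
    refine tendsto_integral_filter_of_dominated_convergence (fun s => C * growthWeight s)
      (.of_forall fun y => ?_) (.of_forall fun y => .of_forall fun s => ?_)
      (integrable_growthWeight.const_mul C) (.of_forall fun s => ?_)
    · exact ((hψ.comp (by fun_prop)).mul continuous_growthWeight).aestronglyMeasurable
    · rw [norm_mul, Real.norm_of_nonneg (growthWeight_pos s).le]
      exact mul_le_mul_of_nonneg_right (hC _) (growthWeight_pos s).le
    · have hc : Continuous fun y : ℝ × ℝ =>
          ψ (y.1 * s.1 + t.1, y.2 * s.2 + t.2) * growthWeight s :=
        (hψ.comp (by fun_prop)).mul continuous_const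
      simpa using (hc.tendsto (0, 0)).mono_left hle
  have hI : ∫ s, growthWeight s = Real.pi ^ 2 := by
    unfold growthWeight
    rw [Measure.volume_eq_prod, integral_prod_mul (fun x : ℝ => (1 + x ^ 2)⁻¹)
      (fun x : ℝ => (1 + x ^ 2)⁻¹), integral_univ_inv_one_add_sq, sq]
  rw [integral_const_mul, hI, mul_comm] at key
  exact key.congr' (hpos.mono fun y hy => (integral_mul_poissonProd ψ hy.1 hy.2 t).symm)

lemma tendsto_integral_integral_mul_poissonProd {μ : Measure (ℝ × ℝ)}
    (hμ : Integrable growthWeight μ) {ψ : ℝ × ℝ → ℝ} {C : ℝ} (hψ : Continuous ψ)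
    (hC : ∀ x, |ψ x| ≤ C * growthWeight x) :
    Tendsto (fun y : ℝ × ℝ => ∫ t, (∫ x, ψ x * poissonProd y t x) ∂μ)
      (𝓝[>] (0 : ℝ) ×ˢ 𝓝[>] (0 : ℝ)) (𝓝 (Real.pi ^ 2 * ∫ t, ψ t ∂μ)) := by
  have hC0 : 0 ≤ C := nonneg_of_mul_nonneg_left ((abs_nonneg _).trans (hC 0)) (growthWeight_pos 0)
  have hIoc : ∀ᶠ y in 𝓝[>] (0 : ℝ), 0 < y ∧ y ≤ 1 := Ioc_mem_nhdsGT one_pos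
  rw [← integral_const_mul]
  refine tendsto_integral_filter_of_dominated_convergence
    -- The factor `2 * 2` bounds `(1 + y₁)(1 + y₂)` once both heights are at most `1`.
    (fun t => C * ((2 * Real.pi) ^ 2 * (2 * 2) * growthWeight t))
    ((hIoc.prod_mk hIoc).mono fun y hy => ?_)
    ((hIoc.prod_mk hIoc).mono fun y hy => .of_forall fun t => ?_)
    ((hμ.const_mul _).const_mul C) (.of_forall fun t => ?_)
  · have hm : Continuous fun p : (ℝ × ℝ) × (ℝ × ℝ) => ψ p.2 * poissonProd y p.1 p.2 :=
      (hψ.comp continuous_snd).mul (continuous_poissonProd hy.1.1 hy.2.1)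
    exact hm.stronglyMeasurable.integral_prod_right.aestronglyMeasurable
  · refine (norm_integral_le_integral_norm _).trans
      ((integral_norm_mul_poissonProd_le hψ hC hy.1.1 hy.2.1 t).trans ?_)
    have := growthWeight_pos t
    have a1 := hy.1.1
    have a2 := hy.2.1
    gcongr
    · linarith [hy.1.2]
    · linarith [hy.2.2]
  · refine tendsto_integral_mul_poissonProd (C := C) hψ (fun x => (hC x).trans ?_) t
    refine mul_le_of_le_one_right hC0 ?_
    unfold growthWeight
    exact mul_le_one₀ (inv_le_one_of_one_le₀ (by nlinarith [sq_nonneg x.1])) (by positivity)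
      (inv_le_one_of_one_le₀ (by nlinarith [sq_nonneg x.2]))

/-! ### The imaginary part of the kernel. -/

/-- Since `Im(-(i/2)u) = -Re(u)/2`, the mixed terms in `A` and `c` cancel up to conjugation. With `c
= 1/(t + i)` the surviving `c₁.im * c₂.im` is exactly what the last term of `kernelK` subtracts. -/
lemma im_add_half_re_eq (A₁ A₂ c₁ c₂ : ℂ) :
    (-(Complex.I / 2) * (A₁ - c₁) * (A₂ - c₂)).im
      + ((starRingEnd ℂ A₁ - c₁) * (A₂ - starRingEnd ℂ c₂)).re / 2 =
      A₁.im * A₂.im + c₁.im * c₂.im := by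
  simp [Complex.mul_im, Complex.mul_re]
  ring

lemma im_one_div_ofReal_sub (t : ℝ) (z : ℂ) :
    (1 / ((t : ℂ) - z)).im = poissonUHP z.im t z.re := by
  rw [one_div, Complex.inv_im, Complex.normSq_apply, poissonUHP]
  simp only [Complex.sub_im, Complex.ofReal_im, Complex.sub_re, Complex.ofReal_re]
  congr 1 <;> ring

lemma im_one_div_ofReal_add_I (t : ℝ) :
    (1 / ((t : ℂ) + Complex.I)).im = -(1 + t ^ 2)⁻¹ := by
  have h := im_one_div_ofReal_sub t (-Complex.I)
  rw [sub_neg_eq_add] at h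
  rw [h, poissonUHP, inv_eq_one_div, ← neg_div]
  simp
  ring

/-- The integrand of the Nevanlinna condition. -/
noncomputable def nevanlinnaIntegrand (z : ℂ × ℂ) (t : ℝ × ℝ) : ℝ :=
  ((1 / ((t.1 : ℂ) - (starRingEnd ℂ) z.1) - 1 / ((t.1 : ℂ) + Complex.I))
    * (1 / ((t.2 : ℂ) - z.2) - 1 / ((t.2 : ℂ) - Complex.I))).re

lemma im_kernelK_eq (z : ℂ × ℂ) (t : ℝ × ℝ) :
    (kernelK z t).im =
      poissonProd (z.1.im, z.2.im) t (z.1.re, z.2.re) - nevanlinnaIntegrand z t / 2 := by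
  have h := im_add_half_re_eq (1 / ((t.1 : ℂ) - z.1)) (1 / ((t.2 : ℂ) - z.2))
    (1 / ((t.1 : ℂ) + Complex.I)) (1 / ((t.2 : ℂ) + Complex.I))
  have e1 : starRingEnd ℂ (1 / ((t.1 : ℂ) - z.1)) = 1 / ((t.1 : ℂ) - starRingEnd ℂ z.1) := by simp
  have e2 : starRingEnd ℂ (1 / ((t.2 : ℂ) + Complex.I)) = 1 / ((t.2 : ℂ) - Complex.I) := by
    simp [sub_eq_add_neg]
  rw [e1, e2, im_one_div_ofReal_sub, im_one_div_ofReal_sub, im_one_div_ofReal_add_I,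
    im_one_div_ofReal_add_I] at h
  have e3 : (Complex.I / ((1 + (t.1 : ℂ) ^ 2) * (1 + (t.2 : ℂ) ^ 2))).im =
      (1 + t.1 ^ 2)⁻¹ * (1 + t.2 ^ 2)⁻¹ := by
    have : Complex.I / ((1 + (t.1 : ℂ) ^ 2) * (1 + (t.2 : ℂ) ^ 2)) =
        (((1 + t.1 ^ 2)⁻¹ * (1 + t.2 ^ 2)⁻¹ : ℝ) : ℂ) * Complex.I := by
      push_cast
      rw [div_eq_mul_inv, mul_inv, mul_comm]
    rw [this, Complex.im_ofReal_mul]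
    simp
  rw [kernelK, Complex.sub_im, e3]
  simp only [nevanlinnaIntegrand, poissonProd]
  linarith

/-! ### Integrability of the kernels under the growth condition. -/

lemma ofReal_sub_ne_zero (t : ℝ) {w : ℂ} (hw : w.im ≠ 0) : (t : ℂ) - w ≠ 0 := fun h =>
  hw (by simpa using congrArg Complex.im h)

lemma ofReal_add_I_ne_zero (t : ℝ) : (t : ℂ) + Complex.I ≠ 0 := fun h => by
  simpa using congrArg Complex.im h

/-- The difference equals `(w + i)/((t - w)(t + i))`, and `|t + i|` is at most a constant times `|t
- w|` because `|t - w| ≥ |Im w|`. Any nonreal `w` is allowed, so that conjugates of `z₁` and `z₂`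
are covered. -/
lemma norm_one_div_sub_le {w : ℂ} (hw : w.im ≠ 0) (t : ℝ) :
    ‖1 / ((t : ℂ) - w) - 1 / ((t : ℂ) + Complex.I)‖ ≤
      ‖w + Complex.I‖ * (1 + ‖w + Complex.I‖ / |w.im|) * (1 + t ^ 2)⁻¹ := by
  have h1 := ofReal_sub_ne_zero t hw
  have h2 := ofReal_add_I_ne_zero t
  have hsq : 1 + t ^ 2 = ‖(t : ℂ) + Complex.I‖ ^ 2 := by
    rw [Complex.sq_norm, Complex.normSq_apply]
    simp
    ring
  have him : |w.im| ≤ ‖(t : ℂ) - w‖ := by simpa using Complex.abs_im_le_norm ((t : ℂ) - w)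
  have hw' : 0 < |w.im| := abs_pos.2 hw
  have hle : ‖(t : ℂ) + Complex.I‖ ≤ (1 + ‖w + Complex.I‖ / |w.im|) * ‖(t : ℂ) - w‖ := by
    calc ‖(t : ℂ) + Complex.I‖ = ‖((t : ℂ) - w) + (w + Complex.I)‖ := by congr 1; ring
      _ ≤ ‖(t : ℂ) - w‖ + ‖w + Complex.I‖ := norm_add_le _ _
      _ = ‖(t : ℂ) - w‖ + ‖w + Complex.I‖ / |w.im| * |w.im| := by
          rw [div_mul_cancel₀ _ hw'.ne']
      _ ≤ ‖(t : ℂ) - w‖ + ‖w + Complex.I‖ / |w.im| * ‖(t : ℂ) - w‖ := by gcongr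
      _ = _ := by ring
  have e : 1 / ((t : ℂ) - w) - 1 / ((t : ℂ) + Complex.I) =
      (w + Complex.I) / (((t : ℂ) - w) * ((t : ℂ) + Complex.I)) := by
    field_simp
    ring
  have n1 : 0 < ‖(t : ℂ) - w‖ := norm_pos_iff.2 h1
  have n2 : 0 < ‖(t : ℂ) + Complex.I‖ := norm_pos_iff.2 h2
  rw [e, hsq, norm_div, norm_mul, ← div_eq_mul_inv, div_le_div_iff₀ (by positivity) (by positivity)]
  calc _ = ‖w + Complex.I‖ * ‖(t : ℂ) + Complex.I‖ * ‖(t : ℂ) + Complex.I‖ := by ring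
    _ ≤ ‖w + Complex.I‖ * ((1 + ‖w + Complex.I‖ / |w.im|) * ‖(t : ℂ) - w‖)
        * ‖(t : ℂ) + Complex.I‖ := by gcongr
    _ = _ := by ring

lemma continuous_one_div_ofReal_sub {w : ℂ} (hw : w.im ≠ 0) :
    Continuous fun t : ℝ => 1 / ((t : ℂ) - w) :=
  Continuous.div continuous_const (by fun_prop) fun t => ofReal_sub_ne_zero t hw

lemma continuous_one_div_ofReal_add_I :
    Continuous fun t : ℝ => 1 / ((t : ℂ) + Complex.I) :=
  Continuous.div continuous_const (by fun_prop) ofReal_add_I_ne_zero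

lemma norm_mul_le_growthWeight {f g : ℝ → ℂ} {M N : ℝ}
    (hf : ∀ t, ‖f t‖ ≤ M * (1 + t ^ 2)⁻¹) (hg : ∀ t, ‖g t‖ ≤ N * (1 + t ^ 2)⁻¹) (t : ℝ × ℝ) :
    ‖f t.1 * g t.2‖ ≤ M * N * growthWeight t := by
  rw [norm_mul]
  refine (mul_le_mul (hf _) (hg _) (norm_nonneg _) ((norm_nonneg _).trans (hf _))).trans_eq ?_
  unfold growthWeight
  ring

lemma integrable_mul_of_norm_le {μ : Measure (ℝ × ℝ)} (hμ : Integrable growthWeight μ)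
    {f g : ℝ → ℂ} (hfc : Continuous f) (hgc : Continuous g) {M N : ℝ}
    (hf : ∀ t, ‖f t‖ ≤ M * (1 + t ^ 2)⁻¹) (hg : ∀ t, ‖g t‖ ≤ N * (1 + t ^ 2)⁻¹) :
    Integrable (fun t : ℝ × ℝ => f t.1 * g t.2) μ :=
  (hμ.const_mul (M * N)).mono'
    ((hfc.comp continuous_fst).mul (hgc.comp continuous_snd)).aestronglyMeasurable
    (.of_forall (norm_mul_le_growthWeight hf hg))

lemma integrable_nevanlinnaIntegrand {μ : Measure (ℝ × ℝ)} (hμ : Integrable growthWeight μ)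
    {z : ℂ × ℂ} (hz : z ∈ polyUpperHalfPlane) : Integrable (nevanlinnaIntegrand z) μ := by
  have h1 : (starRingEnd ℂ z.1).im ≠ 0 := by simpa using hz.1.ne'
  have h2 : (starRingEnd ℂ z.2).im ≠ 0 := by simpa using hz.2.ne'
  -- Conjugation turns `-i` into `+i`, the form bounded by `norm_one_div_sub_le`.
  have e : ∀ t : ℝ, 1 / ((t : ℂ) - z.2) - 1 / ((t : ℂ) - Complex.I) = starRingEnd ℂ
      (1 / ((t : ℂ) - starRingEnd ℂ z.2) - 1 / ((t : ℂ) + Complex.I)) := fun t => by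
    simp [sub_eq_add_neg]
  exact Integrable.re (𝕜 := ℂ) (integrable_mul_of_norm_le hμ
    (f := fun t => 1 / ((t : ℂ) - starRingEnd ℂ z.1) - 1 / ((t : ℂ) + Complex.I))
    (g := fun t => 1 / ((t : ℂ) - z.2) - 1 / ((t : ℂ) - Complex.I))
    ((continuous_one_div_ofReal_sub h1).sub continuous_one_div_ofReal_add_I)
    ((continuous_one_div_ofReal_sub hz.2.ne').sub
      (continuous_one_div_ofReal_sub (by simp))) (norm_one_div_sub_le h1)
    fun t => (congrArg norm (e t)).trans_le ((Complex.norm_conj _).trans_le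
      (norm_one_div_sub_le h2 t)))

lemma integrable_kernelK {μ : Measure (ℝ × ℝ)} (hμ : Integrable growthWeight μ)
    {z : ℂ × ℂ} (hz : z ∈ polyUpperHalfPlane) : Integrable (kernelK z) μ := by
  have h1 := integrable_mul_of_norm_le hμ
    ((continuous_one_div_ofReal_sub hz.1.ne').sub continuous_one_div_ofReal_add_I)
    ((continuous_one_div_ofReal_sub hz.2.ne').sub continuous_one_div_ofReal_add_I)
    (norm_one_div_sub_le hz.1.ne') (norm_one_div_sub_le hz.2.ne')
  refine ((h1.const_mul (-(Complex.I / 2))).sub (hμ.ofReal.const_mul Complex.I)).congr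
    (.of_forall fun t => ?_)
  simp only [Pi.sub_apply, kernelK, growthWeight]
  push_cast
  rw [mul_assoc, div_eq_mul_inv Complex.I (_ * _), mul_inv]
  rfl

/-! ### Reduction to finite measures. -/

lemma GrowthCondition.integrable_growthWeight {μ : Measure (ℝ × ℝ)} (h : GrowthCondition μ) :
    Integrable growthWeight μ :=
  h.congr (.of_forall fun t => (growthWeight_eq t).symm)

lemma withDensity_growthWeight_inv (μ : Measure (ℝ × ℝ)) :
    (μ.withDensity fun t => ENNReal.ofReal (growthWeight t)).withDensity
      (fun t => ENNReal.ofReal (growthWeight t)⁻¹) = μ := by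
  have h := withDensity_inv_same (μ := μ) (f := fun t => ENNReal.ofReal (growthWeight t))
    continuous_growthWeight.measurable.ennreal_ofReal
    (.of_forall fun t => by simpa using growthWeight_pos t) (.of_forall fun t => by simp)
  simpa only [ENNReal.ofReal_inv_of_pos (growthWeight_pos _)] using h

/-- `μ` is a finite measure with a finite real density; σ-finiteness is what Fubini needs later. -/
lemma sigmaFinite_of_integrable_growthWeight {μ : Measure (ℝ × ℝ)}
    (hμ : Integrable growthWeight μ) : SigmaFinite μ := by
  have := isFiniteMeasure_withDensity_ofReal hμ.2
  rw [← withDensity_growthWeight_inv μ]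
  exact SigmaFinite.withDensity_ofReal _

/-- Weighting makes both measures finite, and bounded continuous functions `f` separate finite
measures. The matching test functions `growthWeight * f` are merely continuous, hence inversion is
proved at that generality. -/
lemma measure_ext_of_integral_eq {μ μ' : Measure (ℝ × ℝ)} (hμ : Integrable growthWeight μ)
    (hμ' : Integrable growthWeight μ')
    (h : ∀ (ψ : ℝ × ℝ → ℝ) (C : ℝ), Continuous ψ → (∀ x, |ψ x| ≤ C * growthWeight x) →
      ∫ t, ψ t ∂μ = ∫ t, ψ t ∂μ') : μ = μ' := by
  have := isFiniteMeasure_withDensity_ofReal hμ.2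
  have := isFiniteMeasure_withDensity_ofReal hμ'.2
  rw [← withDensity_growthWeight_inv μ, ← withDensity_growthWeight_inv μ']
  congr 1
  refine ext_of_forall_integral_eq_of_IsFiniteMeasure fun f => ?_
  have hm := continuous_growthWeight.measurable.ennreal_ofReal
  rw [integral_withDensity_eq_integral_toReal_smul hm (.of_forall fun t => by simp),
    integral_withDensity_eq_integral_toReal_smul hm (.of_forall fun t => by simp)]
  simp only [ENNReal.toReal_ofReal (growthWeight_pos _).le, smul_eq_mul]
  refine h _ ‖f‖ (continuous_growthWeight.mul f.continuous) fun t => ?_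
  rw [abs_mul, abs_of_pos (growthWeight_pos t), mul_comm]
  exact mul_le_mul_of_nonneg_right (f.norm_coe_le_norm t) (growthWeight_pos t).le

/-! ### Poisson representation of the imaginary part, and inversion. -/

lemma IsRepresentation.im_eq {q : ℂ × ℂ → ℂ} {a b₁ b₂ : ℝ} {μ : Measure (ℝ × ℝ)}
    (h : IsRepresentation q a b₁ b₂ μ) {z : ℂ × ℂ} (hz : z ∈ polyUpperHalfPlane) :
    (q z).im = b₁ * z.1.im + b₂ * z.2.im
      + (Real.pi ^ 2)⁻¹ * ∫ t, poissonProd (z.1.im, z.2.im) t (z.1.re, z.2.re) ∂μ := by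
  have hμ := h.growth.integrable_growthWeight
  have hK := integrable_kernelK hμ hz
  have hN := integrable_nevanlinnaIntegrand hμ hz
  have hN0 : ∫ t, nevanlinnaIntegrand z t ∂μ = 0 := h.nevanlinna z hz
  have e : ∫ t, poissonProd (z.1.im, z.2.im) t (z.1.re, z.2.re) ∂μ = (∫ t, kernelK z t ∂μ).im := by
    have hKi : ∫ t, (kernelK z t).im ∂μ = (∫ t, kernelK z t ∂μ).im := integral_im (𝕜 := ℂ) hK
    have : ∀ t, poissonProd (z.1.im, z.2.im) t (z.1.re, z.2.re) =
        (kernelK z t).im + nevanlinnaIntegrand z t / 2 := fun t => by rw [im_kernelK_eq]; ring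
    simp_rw [this]
    have hKim : Integrable (fun t => (kernelK z t).im) μ := Integrable.im (𝕜 := ℂ) hK
    rw [integral_add hKim (hN.div_const 2), integral_div, hN0, hKi]
    simp
  have hπ : (1 / (Real.pi : ℂ) ^ 2) = (((Real.pi ^ 2)⁻¹ : ℝ) : ℂ) := by push_cast; rw [one_div]
  rw [h.eq z hz, e, hπ]
  simp only [Complex.add_im, Complex.im_ofReal_mul, Complex.ofReal_im]
  ring

lemma IsRepresentation.im_apply_eq {q : ℂ × ℂ → ℂ} {a b₁ b₂ : ℝ} {μ : Measure (ℝ × ℝ)}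
    (h : IsRepresentation q a b₁ b₂ μ) {y : ℝ × ℝ} (h1 : 0 < y.1) (h2 : 0 < y.2) (x : ℝ × ℝ) :
    (q ((x.1 : ℂ) + Complex.I * (y.1 : ℂ), (x.2 : ℂ) + Complex.I * (y.2 : ℂ))).im =
      b₁ * y.1 + b₂ * y.2 + (Real.pi ^ 2)⁻¹ * ∫ t, poissonProd y t x ∂μ := by
  have hz : ((x.1 : ℂ) + Complex.I * (y.1 : ℂ), (x.2 : ℂ) + Complex.I * (y.2 : ℂ)) ∈
      polyUpperHalfPlane := ⟨by simpa using h1, by simpa using h2⟩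
  simpa using h.im_eq hz

section StieltjesInversion

variable {q : ℂ × ℂ → ℂ} {a b₁ b₂ : ℝ} {μ : Measure (ℝ × ℝ)} {ψ : ℝ × ℝ → ℝ} {C : ℝ}

lemma mul_im_eq (h : IsRepresentation q a b₁ b₂ μ) {y : ℝ × ℝ} (h1 : 0 < y.1) (h2 : 0 < y.2) :
    (fun x : ℝ × ℝ =>
      ψ x * (q ((x.1 : ℂ) + Complex.I * (y.1 : ℂ), (x.2 : ℂ) + Complex.I * (y.2 : ℂ))).im) =
    fun x => (b₁ * y.1 + b₂ * y.2) * ψ x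
      + (Real.pi ^ 2)⁻¹ * ∫ t, ψ x * poissonProd y t x ∂μ := by
  funext x
  rw [h.im_apply_eq h1 h2, integral_const_mul]
  ring

lemma IsRepresentation.integrable_integral_mul_poissonProd (h : IsRepresentation q a b₁ b₂ μ)
    (hψ : Continuous ψ) (hC : ∀ x, |ψ x| ≤ C * growthWeight x) {y : ℝ × ℝ} (h1 : 0 < y.1)
    (h2 : 0 < y.2) : Integrable fun x => ∫ t, ψ x * poissonProd y t x ∂μ := by
  have hμ := h.growth.integrable_growthWeight
  have := sigmaFinite_of_integrable_growthWeight hμ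
  exact (integrable_prod_mul_poissonProd hμ hψ hC h1 h2).integral_prod_left

lemma IsRepresentation.integrable_mul_im (h : IsRepresentation q a b₁ b₂ μ)
    (hψ : Continuous ψ) (hC : ∀ x, |ψ x| ≤ C * growthWeight x) {y : ℝ × ℝ} (h1 : 0 < y.1)
    (h2 : 0 < y.2) : Integrable fun x : ℝ × ℝ =>
      ψ x * (q ((x.1 : ℂ) + Complex.I * (y.1 : ℂ), (x.2 : ℂ) + Complex.I * (y.2 : ℂ))).im := by
  rw [mul_im_eq h h1 h2]
  exact ((integrable_of_le_growthWeight integrable_growthWeight hψ hC).const_mul _).add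
    ((h.integrable_integral_mul_poissonProd hψ hC h1 h2).const_mul _)

lemma IsRepresentation.integral_mul_im (h : IsRepresentation q a b₁ b₂ μ)
    (hψ : Continuous ψ) (hC : ∀ x, |ψ x| ≤ C * growthWeight x) {y : ℝ × ℝ} (h1 : 0 < y.1)
    (h2 : 0 < y.2) : ∫ x : ℝ × ℝ,
      ψ x * (q ((x.1 : ℂ) + Complex.I * (y.1 : ℂ), (x.2 : ℂ) + Complex.I * (y.2 : ℂ))).im =
      (b₁ * y.1 + b₂ * y.2) * (∫ x, ψ x)
        + (Real.pi ^ 2)⁻¹ * ∫ t, (∫ x, ψ x * poissonProd y t x) ∂μ := by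
  have hμ := h.growth.integrable_growthWeight
  have := sigmaFinite_of_integrable_growthWeight hμ
  rw [mul_im_eq h h1 h2, integral_add
    ((integrable_of_le_growthWeight integrable_growthWeight hψ hC).const_mul _)
    ((h.integrable_integral_mul_poissonProd hψ hC h1 h2).const_mul _),
    integral_const_mul, integral_const_mul,
    integral_integral_swap (integrable_prod_mul_poissonProd hμ hψ hC h1 h2)]

/-- Stieltjes inversion for continuous test functions. -/
lemma IsRepresentation.tendsto_integral_mul_im (h : IsRepresentation q a b₁ b₂ μ)
    (hψ : Continuous ψ) (hC : ∀ x, |ψ x| ≤ C * growthWeight x) :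
    Tendsto (fun y : ℝ × ℝ => ∫ x : ℝ × ℝ,
      ψ x * (q ((x.1 : ℂ) + Complex.I * (y.1 : ℂ), (x.2 : ℂ) + Complex.I * (y.2 : ℂ))).im)
      (𝓝[>] (0 : ℝ) ×ˢ 𝓝[>] (0 : ℝ)) (𝓝 (∫ t, ψ t ∂μ)) := by
  have hpos : ∀ᶠ y : ℝ × ℝ in 𝓝[>] (0 : ℝ) ×ˢ 𝓝[>] (0 : ℝ), 0 < y.1 ∧ 0 < y.2 :=
    (eventually_mem_nhdsWithin (a := (0 : ℝ)) (s := Set.Ioi 0)).prod_mk eventually_mem_nhdsWithin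
  have hle : 𝓝[>] (0 : ℝ) ×ˢ 𝓝[>] (0 : ℝ) ≤ 𝓝 ((0 : ℝ), (0 : ℝ)) := by
    rw [nhds_prod_eq]
    exact Filter.prod_mono nhdsWithin_le_nhds nhdsWithin_le_nhds
  have hlin : Tendsto (fun y : ℝ × ℝ => (b₁ * y.1 + b₂ * y.2) * ∫ x, ψ x)
      (𝓝[>] (0 : ℝ) ×ˢ 𝓝[>] (0 : ℝ)) (𝓝 0) := by
    have hc : Continuous fun y : ℝ × ℝ => (b₁ * y.1 + b₂ * y.2) * ∫ x, ψ x := by fun_prop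
    simpa using (hc.tendsto (0, 0)).mono_left hle
  have hmain := hlin.add ((tendsto_integral_integral_mul_poissonProd
    h.growth.integrable_growthWeight hψ hC).const_mul (Real.pi ^ 2)⁻¹)
  rw [zero_add, inv_mul_cancel_left₀ (by positivity)] at hmain
  exact hmain.congr' (hpos.mono fun y hy => (h.integral_mul_im hψ hC hy.1 hy.2).symm)

end StieltjesInversion

theorem mainTheorem2 (q : ℂ × ℂ → ℂ) (hq : IsHerglotzNevanlinna q) :
    (∀ (a b₁ b₂ : ℝ) (μ : Measure (ℝ × ℝ)), IsRepresentation q a b₁ b₂ μ →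
      ∀ (ψ : ℝ × ℝ → ℝ) (C : ℝ), ContDiff ℝ 1 ψ →
        (∀ x : ℝ × ℝ, |ψ x| ≤ C / ((1 + x.1 ^ 2) * (1 + x.2 ^ 2))) →
        Integrable ψ μ ∧
        (∀ y₁ y₂ : ℝ, 0 < y₁ → 0 < y₂ →
          Integrable (fun x : ℝ × ℝ =>
            ψ x * (q ((x.1 : ℂ) + Complex.I * (y₁ : ℂ), (x.2 : ℂ) + Complex.I * (y₂ : ℂ))).im)) ∧
        Tendsto
          (fun y : ℝ × ℝ => ∫ x : ℝ × ℝ,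
            ψ x * (q ((x.1 : ℂ) + Complex.I * (y.1 : ℂ), (x.2 : ℂ) + Complex.I * (y.2 : ℂ))).im)
          (𝓝[>] (0 : ℝ) ×ˢ 𝓝[>] (0 : ℝ))
          (𝓝 (∫ t, ψ t ∂μ))) ∧
    (∀ (a b₁ b₂ a' b₁' b₂' : ℝ) (μ μ' : Measure (ℝ × ℝ)),
      IsRepresentation q a b₁ b₂ μ → IsRepresentation q a' b₁' b₂' μ' → μ = μ') := by

  refine ⟨fun a b₁ b₂ μ h ψ C hψ hC => ?_, fun a b₁ b₂ a' b₁' b₂' μ μ' h h' => ?_⟩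
  · have hC' : ∀ x, |ψ x| ≤ C * growthWeight x := fun x => by
      rw [growthWeight_eq, mul_one_div]
      exact hC x
    exact ⟨integrable_of_le_growthWeight h.growth.integrable_growthWeight hψ.continuous hC',
      fun y₁ y₂ h1 h2 => h.integrable_mul_im (y := (y₁, y₂)) hψ.continuous hC' h1 h2,
      h.tendsto_integral_mul_im hψ.continuous hC'⟩
  · exact measure_ext_of_integral_eq h.growth.integrable_growthWeight
      h'.growth.integrable_growthWeight fun ψ C hψ hC =>
        tendsto_nhds_unique (h.tendsto_integral_mul_im hψ hC) (h'.tendsto_integral_mul_im hψ hC)
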